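/- For a vector $x\in\mathbb R^n$ and $S\subseteq\{1,\dots,n\}$ let $x_S$ be the part of $x$ over $S$, let $\|x_S\|_1=\sum_{i\in S}|x_i|$, and let $\overline S=\{1,\dots,n\}\setminus S$. Given a real $m\times n$ matrix $A$ and $x\in\mathbb R^n$, an $\ell_1$ minimizer for $x$ is a solution $\hat x$ of the problem: minimize $\|z\|_1$ over all $z\in\mathbb R^n$ with $Az=Ax$. Theorem. For all real $C>1$ and $\delta>0$ there exist constants $\zeta=\zeta(\delta,C)>0$ and $c=c(\delta,C)>0$ such that the following holds. Let $(m_n)$ be any sequence of integers with $0\le m_n\le n$ and $m_n/n\to\delta$ as $n\to\infty$. For each $n$ let $A$ be a random $m_n\times n$ real matrix which either has independent standard normal entries or is any random matrix whose null space is (almost surely) a uniformly distributed $(n-m_n)$-dimensional subspace of $\mathbb R^n$, i.e. its law on the Grassmann manifold $\mathrm{Gr}_{n-m_n}(n)$ is the probability measure invariant under all orthogonal transformations. Then for all sufficiently large $n$, with probability at least $1-e^{-cn}$, both of the following hold at the same time: (i) for every $w$ in the null space of $A$ and every $K\subseteq\{1,\dots,n\}$ with $|K|\le\zeta n$, $$C\,\|w_K\|_1\le\|w_{\overline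 K}\|_1;$$ (ii) for every $x\in\mathbb R^n$, every $\ell_1$ minimizer $\hat x$ for $x$, and every $K\subseteq\{1,\dots,n\}$ with $|K|\le\zeta n$, $$\|\hat x-x\|_1\le\frac{2(C+1)\Delta}{C-1},\qquad \Delta=\|x_{\overline K}\|_1 .$$ -/

import Mathlib

open MeasureTheory ProbabilityTheory Filter Topology

noncomputable section

/-- The Grassmann manifold `Gr_d(n)`: the set of `d`-dimensional linear subspaces of `ℝⁿ`. -/
def Grassmann (n d : ℕ) : Type :=
  {V : Submodule ℝ (EuclideanSpace ℝ (Fin n)) // Module.finrank ℝ V = d}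

namespace Grassmann

variable {n d : ℕ}

/-- The orthogonal projection of `ℝⁿ` onto the subspace `V`. -/
def proj (V : Grassmann n d) :
    EuclideanSpace ℝ (Fin n) →L[ℝ] EuclideanSpace ℝ (Fin n) :=
  V.1.starProjection

/-- The usual topology of the Grassmann manifold: a subspace is identified with the orthogonal
projection onto it, and projections are compared in operator norm. -/
instance : TopologicalSpace (Grassmann n d) := TopologicalSpace.induced proj inferInstance

instance : MeasurableSpace (Grassmann n d) := borel (Grassmann n d)

instance : BorelSpace (Grassmann n d) := ⟨rfl⟩

/-- The image `Θ V` of the subspace `V` under the orthogonal transformation `Θ` of `ℝⁿ`. -/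
def rotate (Θ : EuclideanSpace ℝ (Fin n) ≃ₗᵢ[ℝ] EuclideanSpace ℝ (Fin n))
    (V : Grassmann n d) : Grassmann n d :=
  ⟨V.1.map Θ.toLinearEquiv.toLinearMap, by
    rw [LinearEquiv.finrank_map_eq]; exact V.2⟩

/-- `μ` is the uniform distribution on `Gr_d(n)`: the probability measure on the Borel sets
that is invariant under all orthogonal transformations of `ℝⁿ`. -/
def IsUniform (μ : Measure (Grassmann n d)) : Prop :=
  IsProbabilityMeasure μ ∧
    ∀ Θ : EuclideanSpace ℝ (Fin n) ≃ₗᵢ[ℝ] EuclideanSpace ℝ (Fin n), μ.map (rotate Θ) = μ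

end Grassmann

/-- The null space of the matrix `A`, as a subspace of `ℝⁿ`. -/
def nullSpace {m n : ℕ} (A : Matrix (Fin m) (Fin n) ℝ) :
    Submodule ℝ (EuclideanSpace ℝ (Fin n)) :=
  LinearMap.ker (Matrix.toEuclideanLin A)

/-- The product `σ`-algebra on real `m × n` matrices. -/
instance {m n : ℕ} : MeasurableSpace (Matrix (Fin m) (Fin n) ℝ) :=
  inferInstanceAs (MeasurableSpace (Fin m → Fin n → ℝ))

/-- If the `m × n` matrix `A` is drawn from the law `μ`, then its null space is (almost surely
`(n - m)`-dimensional and) uniformly distributed on the Grassmann manifold `Gr_{n-m}(n)`. -/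
def HasUniformNullSpace {m n : ℕ} (μ : Measure (Matrix (Fin m) (Fin n) ℝ)) : Prop :=
  ∃ V : Matrix (Fin m) (Fin n) ℝ → Grassmann n (n - m),
    AEMeasurable V μ ∧ (∀ᵐ A ∂μ, (V A).1 = nullSpace A) ∧ Grassmann.IsUniform (μ.map V)

/-- The law of an `m × n` matrix with independent standard normal entries. -/
def gaussianMatrix (m n : ℕ) : Measure (Matrix (Fin m) (Fin n) ℝ) :=
  Measure.pi fun _ : Fin m => Measure.pi fun _ : Fin n => gaussianReal 0 1

/-- `‖x_S‖₁`, the `ℓ₁` norm of the part of the vector `x` over the index set `S`. -/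
def l1On {n : ℕ} (S : Finset (Fin n)) (x : Fin n → ℝ) : ℝ := ∑ i ∈ S, |x i|

/-- `‖x‖₁`. -/
def l1 {n : ℕ} (x : Fin n → ℝ) : ℝ := ∑ i, |x i|

/-- `z` is a solution of the problem: minimize `‖z‖₁` subject to `A z = y`. -/
def IsL1Minimizer {m n : ℕ} (A : Matrix (Fin m) (Fin n) ℝ) (y : Fin m → ℝ)
    (z : Fin n → ℝ) : Prop :=
  A.mulVec z = y ∧ ∀ z' : Fin n → ℝ, A.mulVec z' = y → l1 z ≤ l1 z'

/-- Every vector `w` in the null space of `A` and every index set `K` with `|K| ≤ k` satisfy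
`C ‖w_K‖₁ ≤ ‖w_{Kᶜ}‖₁`. -/
def NullSpaceBalanced {m n : ℕ} (A : Matrix (Fin m) (Fin n) ℝ) (C k : ℝ) : Prop :=
  ∀ w : Fin n → ℝ, A.mulVec w = 0 →
    ∀ K : Finset (Fin n), (K.card : ℝ) ≤ k → C * l1On K w ≤ l1On Kᶜ w

/-- For every signal `x`, every solution `x'` of the `ℓ₁` minimization with data `y = A x` and
every index set `K` with `|K| ≤ k`, the recovery error satisfies
`‖x' - x‖₁ ≤ 2 (C + 1) Δ / (C - 1)` with `Δ = ‖x_{Kᶜ}‖₁`. -/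
def L1Robust {m n : ℕ} (A : Matrix (Fin m) (Fin n) ℝ) (C k : ℝ) : Prop :=
  ∀ x x' : Fin n → ℝ, IsL1Minimizer A (A.mulVec x) x' →
    ∀ K : Finset (Fin n), (K.card : ℝ) ≤ k →
      l1 (x' - x) ≤ 2 * (C + 1) * l1On Kᶜ x / (C - 1)

end

/-! ### Haar-random rotations, seminorms and subspaces. -/

section Rotations

variable {E : Type*} [NormedAddCommGroup E] [InnerProductSpace ℝ E] [FiniteDimensional ℝ E]

/-! If `w` in the null space violates (i), then `‖w‖₁ < (1 + C) ‖w_K‖₁`, and Cauchy–Schwarz on `K`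
makes `‖w‖₁` at most `ε √n ‖w‖₂`, where `ε` is small with `ζ`. It is therefore enough that a random
subspace rarely contains such a vector; (ii) follows from (i) deterministically.

For one vector, comparing the volumes of the `ℓ₁` and Euclidean balls shows that a Haar-random
rotation gives it `ℓ₁` norm at most `r √n` times its length with probability at most `(e r)^n`
(`haar_l1Seminorm_le`). Passing to a `d`-dimensional subspace costs a factor `(2/ε)^d`
(`haar_hasSmallVector_le`), by a volume argument in place of a net. With `d = n - m` the bound is at
most `(8e)^n ε^m`, exponentially small because `m` is proportional to `n`. Both matrix models reduce
to rotations of fixed subspaces by rotation invariance and Fubini (`measure_hasSmallVector_le`). -/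

instance compactSpace_unitary : CompactSpace (unitary (E →L[ℝ] E)) := by
  have : ProperSpace (E →L[ℝ] E) := FiniteDimensional.proper_real _
  refine isCompact_iff_compactSpace.mp (Metric.isCompact_of_isClosed_isBounded isClosed_unitary ?_)
  refine (Metric.isBounded_closedBall (x := (0 : E →L[ℝ] E)) (r := 1)).subset fun u hu => ?_
  rw [mem_closedBall_zero_iff]
  exact ContinuousLinearMap.opNorm_le_bound _ zero_le_one fun x => by
    simpa using (Unitary.norm_map (⟨u, hu⟩ : unitary (E →L[ℝ] E)) x).le

instance secondCountableTopology_unitary :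
    SecondCountableTopology (unitary (E →L[ℝ] E)) := by
  have : ProperSpace (E →L[ℝ] E) := FiniteDimensional.proper_real _
  infer_instance

@[simp]
lemma unitary_apply_inv_apply (u : unitary (E →L[ℝ] E)) (x : E) :
    (u : E →L[ℝ] E) ((↑(u⁻¹) : E →L[ℝ] E) x : E) = x := by
  rw [← mul_apply_eq_comp, ← Submonoid.coe_mul, mul_inv_cancel]; rfl

@[simp]
lemma unitary_inv_apply_apply (u : unitary (E →L[ℝ] E)) (x : E) :
    (↑(u⁻¹) : E →L[ℝ] E) ((u : E →L[ℝ] E) x) = x := by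
  rw [← mul_apply_eq_comp, ← Submonoid.coe_mul, inv_mul_cancel]; rfl

/-- The orthogonal group acts transitively on spheres. -/
lemma exists_unitary_apply_eq {x y : E} (h : ‖x‖ = ‖y‖) :
    ∃ u : unitary (E →L[ℝ] E), (u : E →L[ℝ] E) x = y :=
  ⟨Unitary.linearIsometryEquiv.symm (ℝ ∙ (x - y))ᗮ.reflection, Submodule.reflection_sub h⟩

lemma continuous_unitary_inv_apply :
    Continuous fun p : unitary (E →L[ℝ] E) × E =>
      ((p.1⁻¹ : unitary (E →L[ℝ] E)) : E →L[ℝ] E) p.2 :=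
  (continuous_subtype_val.comp (continuous_inv.comp continuous_fst)).clm_apply continuous_snd

variable [MeasurableSpace E] [BorelSpace E]

lemma measurePreserving_unitary (u : unitary (E →L[ℝ] E)) :
    MeasurePreserving (u : E →L[ℝ] E) (volume : Measure E) volume :=
  (Unitary.linearIsometryEquiv u).measurePreserving

omit [MeasurableSpace E] [BorelSpace E] in
variable (E) in
lemma exists_haar_unitary : ∃ H : Measure (unitary (E →L[ℝ] E)),
    IsProbabilityMeasure H ∧ H.IsMulLeftInvariant :=
  ⟨Measure.haarMeasure ⊤, ⟨Measure.haarMeasure_self⟩, inferInstance⟩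

variable (H : Measure (unitary (E →L[ℝ] E))) [IsProbabilityMeasure H] [H.IsMulLeftInvariant]

/-- The chance that a random rotation makes a seminorm small at a fixed vector. -/
lemma haar_seminorm_le_mul_volume_ball_le (N : Seminorm ℝ E) (hN : Continuous N) {s : ℝ}
    (hs : 0 ≤ s) {x : E} (hx : x ≠ 0) :
    H {u : unitary (E →L[ℝ] E) | N ((↑(u⁻¹) : E →L[ℝ] E) x : E) ≤ s * ‖x‖} *
        volume (Metric.ball (0 : E) 1)
      ≤ volume {y : E | N y ≤ s} := by
  set p := H {u : unitary (E →L[ℝ] E) | N ((↑(u⁻¹) : E →L[ℝ] E) x : E) ≤ s * ‖x‖} with hp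
  -- Transitivity on spheres, homogeneity of `N` and left invariance of `H` make the probability the
  -- same at all nonzero vectors.
  have key (y : E) :
      p ≤ H {u : unitary (E →L[ℝ] E) | N ((↑(u⁻¹) : E →L[ℝ] E) y : E) ≤ s * ‖y‖} := by
    rcases eq_or_ne y 0 with rfl | hy
    · simpa using prob_le_one
    obtain ⟨R, hR⟩ := exists_unitary_apply_eq (x := x) (y := (‖x‖ / ‖y‖) • y) (by
      rw [norm_smul, norm_div, norm_norm, norm_norm, div_mul_cancel₀ _ (norm_ne_zero_iff.2 hy)])
    rw [hp, ← measure_preimage_mul H R⁻¹]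
    refine measure_mono fun u hu => ?_
    have hx' := norm_pos_iff.2 hx
    have hy' := norm_pos_iff.2 hy
    have e : (((R⁻¹ * u)⁻¹ : unitary (E →L[ℝ] E)) : E →L[ℝ] E) x
        = (‖x‖ / ‖y‖) • ((↑(u⁻¹) : E →L[ℝ] E) y : E) := by
      rw [mul_inv_rev, inv_inv, Submonoid.coe_mul, mul_apply_eq_comp, hR, map_smul]
    simp only [Set.mem_preimage, Set.mem_ofPred_eq] at hu ⊢
    rw [e, map_smul_eq_mul, Real.norm_of_nonneg (by positivity), div_mul_eq_mul_div,
      div_le_iff₀ hy', mul_right_comm, mul_comm] at hu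
    exact le_of_mul_le_mul_right hu hx'
  -- Count the pairs in two ways: slices over `y` in the ball have measure at least `p`, while
  -- slices over `u` lie in a rotated copy of `{N ≤ s}`.
  set S : Set (unitary (E →L[ℝ] E) × E) :=
    {q | N ((↑(q.1⁻¹) : E →L[ℝ] E) q.2 : E) ≤ s * ‖q.2‖ ∧ q.2 ∈ Metric.ball (0 : E) 1}
    with hS
  have hSm : MeasurableSet S := by
    refine MeasurableSet.inter (IsClosed.measurableSet ?_)
      (measurable_snd Metric.isOpen_ball.measurableSet)
    exact isClosed_le (hN.comp continuous_unitary_inv_apply) (by fun_prop)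
  calc p * volume (Metric.ball (0 : E) 1)
      = ∫⁻ y in Metric.ball (0 : E) 1, p := by simp
    _ ≤ ∫⁻ y in Metric.ball (0 : E) 1, H ((fun u => (u, y)) ⁻¹' S) := by
        refine setLIntegral_mono' Metric.isOpen_ball.measurableSet fun y hy => ?_
        refine (key y).trans (measure_mono fun u hu => ⟨hu, hy⟩)
    _ ≤ ∫⁻ y, H ((fun u => (u, y)) ⁻¹' S) := setLIntegral_le_lintegral _ _
    _ = ∫⁻ u, volume (Prod.mk u ⁻¹' S) ∂H := by
        rw [← Measure.prod_apply_symm hSm, Measure.prod_apply hSm]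
    _ ≤ ∫⁻ _, volume {y : E | N y ≤ s} ∂H := by
        refine lintegral_mono fun u => ?_
        rw [← (measurePreserving_unitary u⁻¹).measure_preimage
          (isClosed_le hN continuous_const).measurableSet.nullMeasurableSet]
        refine measure_mono fun y hy => ?_
        have h2 := mem_ball_zero_iff.1 hy.2
        exact hy.1.trans (by simpa using mul_le_mul_of_nonneg_left h2.le hs)
    _ = _ := by simp

/-- The subspace `V` contains a nonzero vector at which `N` is small relative to the norm. -/
def HasSmallVector (N : Seminorm ℝ E) (t : ℝ) (V : Submodule ℝ E) : Prop :=
  ∃ w ∈ V, w ≠ 0 ∧ N w ≤ t * ‖w‖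

omit [H.IsMulLeftInvariant] in
/-- A bound for the chance that a random rotation of a fixed subspace contains a vector at which
`N` is small, from such a bound for fixed vectors. -/
lemma haar_hasSmallVector_le (N : Seminorm ℝ E) (hN : Continuous N) {L ε : ℝ}
    (hL : ∀ x, N x ≤ L * ‖x‖) (hL0 : 0 ≤ L) (hε : 0 < ε) (hε2 : ε ≤ 1 / 2) {p : ENNReal}
    (hp : ∀ x : E, x ≠ 0 →
      H {u : unitary (E →L[ℝ] E) | N ((↑(u⁻¹) : E →L[ℝ] E) x : E) ≤ 4 * ε * L * ‖x‖} ≤ p)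
    (V : Submodule ℝ E) :
    H {u : unitary (E →L[ℝ] E) | HasSmallVector N (ε * L) (V.comap (u : E →L[ℝ] E).toLinearMap)}
      ≤ ENNReal.ofReal ((2 / ε) ^ Module.finrank ℝ V) * p := by
  set d := Module.finrank ℝ V
  set b := volume (Metric.ball (0 : V) 1) with hb
  have hb0 : b ≠ 0 := (Metric.measure_ball_pos _ _ one_pos).ne'
  have hbt : b ≠ ⊤ := measure_ball_lt_top.ne
  set S : Set (unitary (E →L[ℝ] E) × V) :=
    {q | N ((↑(q.1⁻¹) : E →L[ℝ] E) (q.2 : E) : E) ≤ 4 * ε * L * ‖q.2‖ ∧ q.2 ≠ 0 ∧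
      q.2 ∈ Metric.ball (0 : V) 2} with hS
  have hSm : MeasurableSet S := by
    refine MeasurableSet.inter (IsClosed.measurableSet ?_)
      ((measurable_snd (isOpen_ne (x := (0 : V))).measurableSet).inter
        (measurable_snd Metric.isOpen_ball.measurableSet))
    exact isClosed_le (hN.comp (continuous_unitary_inv_apply.comp (by fun_prop :
      Continuous fun q : unitary (E →L[ℝ] E) × V => (q.1, (q.2 : E))))) (by fun_prop)
  -- One small unit vector `w'` forces its whole `ε`-ball in `V` into the slice: there `N ≤ 2εL` and
  -- the norm is at least `1/2`, whence the factor 4 in `S`.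
  have hsub : {u : unitary (E →L[ℝ] E) |
      HasSmallVector N (ε * L) (V.comap (u : E →L[ℝ] E).toLinearMap)} ⊆
      {u : unitary (E →L[ℝ] E) | ENNReal.ofReal (ε ^ d) * b ≤ volume (Prod.mk u ⁻¹' S)} := by
    rintro u ⟨w, hwV, hw0, hw⟩
    have hwn := norm_pos_iff.2 hw0
    set w' : V := ‖w‖⁻¹ • ⟨(u : E →L[ℝ] E) w, hwV⟩ with hw'
    have hw1 : ‖w'‖ = 1 := by
      rw [hw', norm_smul, Submodule.coe_norm, Unitary.norm_map, norm_inv, norm_norm,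
        inv_mul_cancel₀ hwn.ne']
    have hNw : N ((↑(u⁻¹) : E →L[ℝ] E) (w' : E) : E) ≤ ε * L := by
      rw [hw', Submodule.coe_smul, map_smul, unitary_inv_apply_apply, map_smul_eq_mul,
        norm_inv, norm_norm, inv_mul_le_iff₀ hwn, mul_comm]
      exact hw
    rw [Set.mem_ofPred_eq, ← Measure.addHaar_ball_of_pos volume w' hε]
    refine measure_mono fun y hy => ?_
    have hyd : ‖y - w'‖ < ε := by simpa [dist_eq_norm] using hy
    have hy1 : ‖y‖ ≤ ‖w'‖ + ‖y - w'‖ := by simpa using norm_add_le w' (y - w')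
    have hy2 : ‖w'‖ - ‖y - w'‖ ≤ ‖y‖ := by
      have := norm_sub_norm_le w' (w' - y)
      rw [norm_sub_rev w' y, sub_sub_cancel] at this
      exact this
    refine ⟨?_, norm_pos_iff.1 (by linarith), mem_ball_zero_iff.2 (by linarith)⟩
    have h3 : N ((↑(u⁻¹) : E →L[ℝ] E) (y : E) : E) ≤ ε * L + L * ‖y - w'‖ := by
      have e : ((↑(u⁻¹) : E →L[ℝ] E) (y : E) : E) =
          ((↑(u⁻¹) : E →L[ℝ] E) (w' : E) : E) +
          ((↑(u⁻¹) : E →L[ℝ] E) ((y - w' : V) : E) : E) := by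
        rw [← map_add]; simp
      rw [e]
      refine (map_add_le_add N _ _).trans (add_le_add hNw ((hL _).trans_eq ?_))
      rw [Unitary.norm_map, Submodule.coe_norm]
    have h4 : L * ‖y - w'‖ ≤ L * ε := mul_le_mul_of_nonneg_left hyd.le hL0
    have h5 : 4 * ε * L * (1 / 2) ≤ 4 * ε * L * ‖y‖ :=
      mul_le_mul_of_nonneg_left (by linarith) (by positivity)
    change N ((↑(u⁻¹) : E →L[ℝ] E) (y : E) : E) ≤ 4 * ε * L * ‖y‖
    linarith
  have hint : ∫⁻ u, volume (Prod.mk u ⁻¹' S) ∂H ≤ p * (ENNReal.ofReal (2 ^ d) * b) := by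
    rw [← Measure.prod_apply hSm, Measure.prod_apply_symm hSm,
      ← Measure.addHaar_ball_of_pos volume (0 : V) two_pos]
    calc ∫⁻ y, H ((fun u => (u, y)) ⁻¹' S)
        ≤ ∫⁻ y, (Metric.ball (0 : V) 2).indicator (fun _ => p) y := by
          refine lintegral_mono fun y => ?_
          by_cases hy : y ≠ 0 ∧ y ∈ Metric.ball (0 : V) 2
          · rw [Set.indicator_of_mem hy.2]
            exact (measure_mono fun u hu => hu.1).trans (hp y (by simpa using hy.1))
          · have : (fun u => (u, y)) ⁻¹' S = ∅ := by
              ext u; simp only [Set.mem_preimage, Set.mem_empty_iff_false, iff_false]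
              exact fun h => hy h.2
            simp [this]
      _ = _ := by
          rw [lintegral_indicator Metric.isOpen_ball.measurableSet]; simp
  -- Markov's inequality; the volume ratio of the balls of radii `2` and `ε` is `(2/ε)^d`.
  refine (measure_mono hsub).trans ((meas_ge_le_lintegral_div
    (measurable_measure_prodMk_left hSm).aemeasurable
    (mul_ne_zero (by simpa using pow_pos hε d) hb0)
    (ENNReal.mul_ne_top ENNReal.ofReal_ne_top hbt)).trans ?_)
  rw [ENNReal.div_le_iff (mul_ne_zero (by simpa using pow_pos hε d) hb0)
    (ENNReal.mul_ne_top ENNReal.ofReal_ne_top hbt)]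
  refine hint.trans_eq ?_
  have : ENNReal.ofReal (2 ^ d) = ENNReal.ofReal ((2 / ε) ^ d) * ENNReal.ofReal (ε ^ d) := by
    rw [← ENNReal.ofReal_mul (by positivity), ← mul_pow, div_mul_cancel₀ _ hε.ne']
  rw [this]; ring

-- By homogeneity the small vector can be taken on the unit sphere, and projecting away a compact
-- factor is a closed map. This supplies the measurability needed for Fubini.
omit [MeasurableSpace E] [BorelSpace E] in
lemma isClosed_hasSmallVector {X : Type*} [TopologicalSpace X] (N : Seminorm ℝ E)
    (hN : Continuous N) (t : ℝ) (W : X → Submodule ℝ E)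
    (hW : IsClosed {q : X × E | q.2 ∈ W q.1}) :
    IsClosed {x | HasSmallVector N t (W x)} := by
  have hc : IsClosed {q : Metric.sphere (0 : E) 1 × X | (q.1 : E) ∈ W q.2 ∧ N q.1 ≤ t} := by
    refine (hW.preimage (f := fun q : Metric.sphere (0 : E) 1 × X => (q.2, (q.1 : E)))
      (by fun_prop)).inter (isClosed_le (hN.comp (by fun_prop)) continuous_const)
  convert! isClosedMap_snd_of_compactSpace _ hc using 1
  ext x
  constructor
  · rintro ⟨w, hw, hw0, hwN⟩
    have hwn := norm_pos_iff.2 hw0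
    refine ⟨(⟨‖w‖⁻¹ • w, by simp [norm_smul, hwn.ne']⟩, x), ⟨(W x).smul_mem _ hw, ?_⟩, rfl⟩
    simp only [map_smul_eq_mul, norm_inv, norm_norm]
    rwa [inv_mul_le_iff₀ hwn, mul_comm]
  · rintro ⟨⟨⟨w, hw⟩, x⟩, ⟨h1, h2⟩, rfl⟩
    have hw1 : ‖w‖ = 1 := by simpa using hw
    exact ⟨w, h1, norm_pos_iff.1 (by simp [hw1]), by simpa [hw1] using h2⟩

omit [MeasurableSpace E] [BorelSpace E] [H.IsMulLeftInvariant] in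
/-- If the law of a random subspace is invariant under rotations, a bound for the random
rotations of fixed subspaces applies to the random subspace. -/
lemma measure_hasSmallVector_le {X : Type*} [TopologicalSpace X] [SecondCountableTopology X]
    [MeasurableSpace X] [BorelSpace X] (μ : Measure X) [IsProbabilityMeasure μ]
    (N : Seminorm ℝ E) (hN : Continuous N) (t : ℝ) (W : X → Submodule ℝ E)
    (hW : IsClosed {q : X × E | q.2 ∈ W q.1})
    (hinv : ∀ u : unitary (E →L[ℝ] E),
      μ {x | HasSmallVector N t ((W x).comap (u : E →L[ℝ] E).toLinearMap)} =
        μ {x | HasSmallVector N t (W x)}) {b : ENNReal}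
    (hb : ∀ᵐ x ∂μ,
      H {u : unitary (E →L[ℝ] E) |
        HasSmallVector N t ((W x).comap (u : E →L[ℝ] E).toLinearMap)} ≤ b) :
    μ {x | HasSmallVector N t (W x)} ≤ b := by
  set S : Set (unitary (E →L[ℝ] E) × X) :=
    {q | HasSmallVector N t ((W q.2).comap (q.1 : E →L[ℝ] E).toLinearMap)} with hS
  have hSm : MeasurableSet S := by
    refine (isClosed_hasSmallVector N hN t
      (fun q : unitary (E →L[ℝ] E) × X =>
        (W q.2).comap (q.1 : E →L[ℝ] E).toLinearMap) ?_).measurableSet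
    exact hW.preimage (f := fun q : (unitary (E →L[ℝ] E) × X) × E =>
      (q.1.2, (q.1.1 : E →L[ℝ] E) q.2)) (by fun_prop)
  -- By invariance the probability equals its average over all rotations; Fubini then fixes the
  -- subspace and randomizes the rotation.
  calc μ {x | HasSmallVector N t (W x)}
      = ∫⁻ u, μ (Prod.mk u ⁻¹' S) ∂H := by
        simp_rw [hS, Set.preimage_ofPred_eq, hinv]; simp
    _ = ∫⁻ x, H ((fun u => (u, x)) ⁻¹' S) ∂μ := by
        rw [← Measure.prod_apply hSm, Measure.prod_apply_symm hSm]
    _ ≤ ∫⁻ _, b ∂μ := lintegral_mono_ae hb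
    _ = b := by simp

end Rotations

/-! ### The `ℓ₁` norm: robust recovery and volume estimates. -/

section EllOne

variable {n : ℕ}

/-- The `ℓ₁` norm as a seminorm on Euclidean space. -/
noncomputable def l1Seminorm (n : ℕ) : Seminorm ℝ (EuclideanSpace ℝ (Fin n)) :=
  Seminorm.of (fun x => l1 x.ofLp)
    (fun x y => by
      simp only [l1, ← Finset.sum_add_distrib]
      exact Finset.sum_le_sum fun i _ => abs_add_le _ _)
    (fun a x => by simp [l1, abs_mul, Finset.mul_sum])

lemma l1Seminorm_apply (x : EuclideanSpace ℝ (Fin n)) : l1Seminorm n x = ∑ i, |x i| := rfl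

lemma continuous_l1Seminorm : Continuous (l1Seminorm n) := by
  change Continuous fun x : EuclideanSpace ℝ (Fin n) => ∑ i, |x i|
  fun_prop

lemma l1On_le_sqrt_mul_norm (K : Finset (Fin n)) (x : EuclideanSpace ℝ (Fin n)) :
    l1On K x.ofLp ≤ √K.card * ‖x‖ := by
  rw [EuclideanSpace.norm_eq, ← Real.sqrt_mul (by positivity)]
  refine Real.le_sqrt_of_sq_le ((sq_sum_le_card_mul_sum_sq (s := K)).trans ?_)
  refine mul_le_mul_of_nonneg_left ?_ (by positivity)
  simp only [Real.norm_eq_abs]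
  exact Finset.sum_le_sum_of_subset_of_nonneg (Finset.subset_univ _) fun _ _ _ => sq_nonneg _

lemma l1Seminorm_le_sqrt_mul_norm (x : EuclideanSpace ℝ (Fin n)) :
    l1Seminorm n x ≤ √n * ‖x‖ := by
  have h := l1On_le_sqrt_mul_norm Finset.univ x
  rwa [Finset.card_univ, Fintype.card_fin] at h

lemma l1On_add_l1On_compl (K : Finset (Fin n)) (x : Fin n → ℝ) :
    l1On K x + l1On Kᶜ x = l1 x :=
  Finset.sum_add_sum_compl K _

lemma l1On_add_le (K : Finset (Fin n)) (x y : Fin n → ℝ) :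
    l1On K (x + y) ≤ l1On K x + l1On K y := by
  simp only [l1On, ← Finset.sum_add_distrib]
  exact Finset.sum_le_sum fun i _ => abs_add_le _ _

lemma l1On_neg (K : Finset (Fin n)) (x : Fin n → ℝ) : l1On K (-x) = l1On K x := by
  simp [l1On]

/-- A matrix whose null space is balanced recovers every signal robustly. -/
lemma NullSpaceBalanced.l1Robust {m : ℕ} {A : Matrix (Fin m) (Fin n) ℝ} {C k : ℝ} (hC : 1 < C)
    (h : NullSpaceBalanced A C k) : L1Robust A C k := by
  intro x x' hx' K hK
  have hw := h (x' - x) (by rw [Matrix.mulVec_sub, hx'.1, sub_self]) K hK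
  have hmin := hx'.2 x rfl
  have h1 : l1On K x ≤ l1On K x' + l1On K (x' - x) := by
    have := l1On_add_le K x' (-(x' - x))
    rwa [l1On_neg, show x' + -(x' - x) = x by abel] at this
  have h2 : l1On Kᶜ (x' - x) ≤ l1On Kᶜ x' + l1On Kᶜ x := by
    have := l1On_add_le Kᶜ x' (-x)
    rwa [l1On_neg, ← sub_eq_add_neg] at this
  rw [← l1On_add_l1On_compl K x, ← l1On_add_l1On_compl K x'] at hmin
  rw [← l1On_add_l1On_compl K, le_div_iff₀ (by linarith)]
  -- For `w = x' - x`, the inequalities give `‖w_{Kᶜ}‖₁ ≤ ‖w_K‖₁ + 2Δ`, and balancedness then gives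
  -- `(C - 1) ‖w_K‖₁ ≤ 2Δ`.
  nlinarith

/-- An unbalanced vector in the null space has small `ℓ₁` norm. -/
lemma hasSmallVector_nullSpace {m : ℕ} {A : Matrix (Fin m) (Fin n) ℝ} {C k t : ℝ} (hC : 0 ≤ C)
    (ht : (1 + C) * √k ≤ t) (h : ¬ NullSpaceBalanced A C k) :
    HasSmallVector (l1Seminorm n) t (nullSpace A) := by
  simp only [NullSpaceBalanced, not_forall, not_le] at h
  obtain ⟨w, hw, K, hK, hlt⟩ := h
  refine ⟨WithLp.toLp 2 w, ?_, ?_, ?_⟩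
  · simp [nullSpace, Matrix.toLpLin_toLp, hw]
  · rintro h0
    have : w = 0 := by simpa using congrArg WithLp.ofLp h0
    simp [this, l1On] at hlt
  · have h1 := l1On_le_sqrt_mul_norm K (WithLp.toLp 2 w)
    have h2 : l1Seminorm n (WithLp.toLp 2 w) = l1On K w + l1On Kᶜ w :=
      (l1On_add_l1On_compl K w).symm
    have h3 := Real.sqrt_le_sqrt hK
    calc l1Seminorm n (WithLp.toLp 2 w) ≤ (1 + C) * l1On K w := by linarith
      _ ≤ (1 + C) * (√k * ‖WithLp.toLp 2 w‖) := by gcongr; exact h1.trans (by gcongr)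
      _ ≤ t * ‖WithLp.toLp 2 w‖ := by rw [← mul_assoc]; gcongr

lemma volume_l1Seminorm_le [NeZero n] {s : ℝ} (hs : 0 ≤ s) :
    volume {y : EuclideanSpace ℝ (Fin n) | l1Seminorm n y ≤ s} =
      ENNReal.ofReal ((2 * s) ^ n / n.factorial) := by
  have h := volume_sum_rpow_le (Fin n) (le_refl (1 : ℝ)) s
  have e : {y : EuclideanSpace ℝ (Fin n) | l1Seminorm n y ≤ s} =
      WithLp.ofLp ⁻¹' {x : Fin n → ℝ | (∑ i, |x i| ^ (1 : ℝ)) ^ (1 / (1 : ℝ)) ≤ s} := by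
    ext y; simp [l1Seminorm_apply]
  have hm : MeasurableSet {x : Fin n → ℝ | (∑ i, |x i| ^ (1 : ℝ)) ^ (1 / (1 : ℝ)) ≤ s} := by
    simp only [Real.rpow_one, div_one]
    exact (isClosed_le (by fun_prop) continuous_const).measurableSet
  rw [e, (PiLp.volume_preserving_ofLp (Fin n)).measure_preimage hm.nullMeasurableSet, h,
    ← ENNReal.ofReal_pow hs, ← ENNReal.ofReal_mul (by positivity)]
  have : Real.Gamma (1 + 1) = 1 := by norm_num
  simp only [Fintype.card_fin, div_one, this, Real.Gamma_nat_eq_factorial]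
  rw [mul_pow]; congr 1; ring

/-- The unit ball contains the open cube of half-side `1/√n`. -/
lemma le_volume_ball [NeZero n] :
    ENNReal.ofReal ((2 / √n) ^ n) ≤ volume (Metric.ball (0 : EuclideanSpace ℝ (Fin n)) 1) := by
  have hn : 0 < (n : ℝ) := by exact_mod_cast Nat.pos_of_neZero n
  have hpos : 0 < 1 / √n := by positivity
  have h : volume (WithLp.ofLp ⁻¹' Metric.ball (0 : Fin n → ℝ) (1 / √n) :
      Set (EuclideanSpace ℝ (Fin n))) = ENNReal.ofReal ((2 / √n) ^ n) := by
    rw [(PiLp.volume_preserving_ofLp (Fin n)).measure_preimage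
      Metric.isOpen_ball.measurableSet.nullMeasurableSet, Real.volume_pi_ball _ hpos]
    simp only [Fintype.card_fin, mul_one_div]
  rw [← h]
  refine measure_mono fun y hy => ?_
  rw [Set.mem_preimage, mem_ball_zero_iff, pi_norm_lt_iff hpos] at hy
  rw [mem_ball_zero_iff, EuclideanSpace.norm_eq, Real.sqrt_lt' one_pos]
  calc ∑ i, ‖y i‖ ^ 2 < ∑ _i : Fin n, (1 / √n) ^ 2 :=
        Finset.sum_lt_sum_of_nonempty Finset.univ_nonempty fun i _ =>
          pow_lt_pow_left₀ (hy i) (norm_nonneg _) two_ne_zero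
    _ = 1 ^ 2 := by
        simp [Real.sq_sqrt hn.le, hn.ne']

/-- The `ℓ₁` norm of a randomly rotated unit vector is rarely much smaller than `√n`. -/
lemma haar_l1Seminorm_le [NeZero n]
    (H : Measure (unitary (EuclideanSpace ℝ (Fin n) →L[ℝ] EuclideanSpace ℝ (Fin n))))
    [IsProbabilityMeasure H] [H.IsMulLeftInvariant] {r : ℝ} (hr : 0 ≤ r)
    {x : EuclideanSpace ℝ (Fin n)} (hx : x ≠ 0) :
    H {u : unitary (EuclideanSpace ℝ (Fin n) →L[ℝ] EuclideanSpace ℝ (Fin n)) |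
      l1Seminorm n ((↑(u⁻¹) : EuclideanSpace ℝ (Fin n) →L[ℝ] EuclideanSpace ℝ (Fin n)) x)
        ≤ r * √n * ‖x‖} ≤ ENNReal.ofReal ((Real.exp 1 * r) ^ n) := by
  have hn : 0 < (n : ℝ) := by exact_mod_cast Nat.pos_of_neZero n
  have hsn : 0 < √(n : ℝ) := Real.sqrt_pos.2 hn
  have ha : 0 < (2 / √(n : ℝ)) ^ n := by positivity
  have h := haar_seminorm_le_mul_volume_ball_le H (l1Seminorm n) continuous_l1Seminorm
    (s := r * √n) (by positivity) hx
  rw [volume_l1Seminorm_le (by positivity)] at h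
  replace h := (mul_le_mul_right le_volume_ball _).trans h
  rw [← ENNReal.le_div_iff_mul_le (by simp [ha]) (by simp),
    ← ENNReal.ofReal_div_of_pos ha] at h
  refine h.trans (ENNReal.ofReal_le_ofReal ?_)
  -- The volume ratio is `r^n n^n / n!`, and `n^n / n! ≤ e^n`.
  have h1 := Real.pow_div_factorial_le_exp n hn.le n
  calc (2 * (r * √n)) ^ n / n.factorial / (2 / √n) ^ n
      = r ^ n * ((n : ℝ) ^ n / n.factorial) := by
        rw [div_right_comm, ← div_pow, mul_div_assoc']
        congr 1
        rw [← mul_pow]; congr 1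
        field_simp
        rw [Real.sq_sqrt hn.le]
    _ ≤ r ^ n * Real.exp n := by gcongr
    _ = (Real.exp 1 * r) ^ n := by rw [mul_pow, ← Real.exp_nat_mul, mul_one, mul_comm]

end EllOne

/-! ### Gaussian matrices: rotation invariance and full rank. -/

section Gaussian

instance {m n : ℕ} : BorelSpace (Matrix (Fin m) (Fin n) ℝ) :=
  inferInstanceAs (BorelSpace (Fin m → Fin n → ℝ))

instance {m n : ℕ} : SecondCountableTopology (Matrix (Fin m) (Fin n) ℝ) :=
  inferInstanceAs (SecondCountableTopology (Fin m → Fin n → ℝ))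

instance {m n : ℕ} : IsProbabilityMeasure (gaussianMatrix m n) :=
  inferInstanceAs (IsProbabilityMeasure
    (Measure.pi fun _ : Fin m => Measure.pi fun _ : Fin n => gaussianReal 0 1))

lemma mem_nullSpace {m n : ℕ} {A : Matrix (Fin m) (Fin n) ℝ} {w : EuclideanSpace ℝ (Fin n)} :
    w ∈ nullSpace A ↔ ∀ i, inner ℝ (WithLp.toLp 2 (A i)) w = 0 := by
  rw [nullSpace, LinearMap.mem_ker, Matrix.toLpLin_apply, WithLp.toLp_eq_zero, funext_iff]
  simp [Matrix.mulVec, dotProduct, PiLp.inner_apply, mul_comm]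

lemma isClosed_mem_nullSpace {m n : ℕ} :
    IsClosed {q : Matrix (Fin m) (Fin n) ℝ × EuclideanSpace ℝ (Fin n) |
      q.2 ∈ nullSpace q.1} := by
  simp only [mem_nullSpace, Set.ofPred_forall]
  refine isClosed_iInter fun i => isClosed_eq ?_ continuous_const
  have : Continuous fun q : Matrix (Fin m) (Fin n) ℝ × EuclideanSpace ℝ (Fin n) => q.1 i :=
    (continuous_apply i).comp continuous_fst
  fun_prop

/-- Apply a rotation to every row of a matrix. -/
noncomputable def rotateRows {m n : ℕ}
    (u : unitary (EuclideanSpace ℝ (Fin n) →L[ℝ] EuclideanSpace ℝ (Fin n)))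
    (A : Matrix (Fin m) (Fin n) ℝ) : Matrix (Fin m) (Fin n) ℝ :=
  fun i => (Unitary.linearIsometryEquiv u (WithLp.toLp 2 (A i))).ofLp

lemma map_rotation_pi_gaussianReal {n : ℕ}
    (f : EuclideanSpace ℝ (Fin n) ≃ₗᵢ[ℝ] EuclideanSpace ℝ (Fin n)) :
    (Measure.pi fun _ : Fin n => gaussianReal 0 1).map
      (fun a => (f (WithLp.toLp 2 a)).ofLp) = Measure.pi fun _ : Fin n => gaussianReal 0 1 := by
  have h1 : Measurable (WithLp.toLp 2 : (Fin n → ℝ) → EuclideanSpace ℝ (Fin n)) := by fun_prop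
  have h2 : Measurable (WithLp.ofLp : EuclideanSpace ℝ (Fin n) → Fin n → ℝ) := by fun_prop
  have h3 : Measurable f := f.continuous.measurable
  change Measure.map (WithLp.ofLp ∘ f ∘ WithLp.toLp 2) _ = _
  rw [← Measure.map_map h2 (h3.comp h1), ← Measure.map_map h3 h1, map_pi_eq_stdGaussian,
    stdGaussian_map, ← map_pi_eq_stdGaussian, Measure.map_map h2 h1]
  exact Measure.map_id

lemma measurePreserving_rotateRows {m n : ℕ}
    (u : unitary (EuclideanSpace ℝ (Fin n) →L[ℝ] EuclideanSpace ℝ (Fin n))) :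
    MeasurePreserving (rotateRows u) (gaussianMatrix m n) (gaussianMatrix m n) := by
  have hm : Measurable fun a : Fin n → ℝ =>
      (Unitary.linearIsometryEquiv u (WithLp.toLp 2 a)).ofLp :=
    (Continuous.measurable (by fun_prop))
  have hmap := map_rotation_pi_gaussianReal (Unitary.linearIsometryEquiv u)
  refine ⟨measurable_pi_lambda _ fun i => hm.comp (measurable_pi_apply i), ?_⟩
  have : ∀ _ : Fin m, SigmaFinite ((Measure.pi fun _ : Fin n => gaussianReal 0 1).map
      (fun a => (Unitary.linearIsometryEquiv u (WithLp.toLp 2 a)).ofLp)) := fun _ => by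
    rw [hmap]; infer_instance
  refine (Measure.pi_map_pi fun _ => hm.aemeasurable).trans ?_
  simp only [hmap]
  rfl

/-- Rotations preserve the inner products with the rows. Together with
`measurePreserving_rotateRows` this gives invariance of the Gaussian null space. -/
lemma nullSpace_rotateRows {m n : ℕ}
    (u : unitary (EuclideanSpace ℝ (Fin n) →L[ℝ] EuclideanSpace ℝ (Fin n)))
    (A : Matrix (Fin m) (Fin n) ℝ) :
    nullSpace (rotateRows u⁻¹ A) = (nullSpace A).comap
      (u : EuclideanSpace ℝ (Fin n) →L[ℝ] EuclideanSpace ℝ (Fin n)).toLinearMap := by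
  ext w
  rw [Submodule.mem_comap, mem_nullSpace, mem_nullSpace]
  refine forall_congr' fun i => ?_
  have h := (Unitary.linearIsometryEquiv u).inner_map_map
    (WithLp.toLp 2 (rotateRows u⁻¹ A i)) w
  have e : Unitary.linearIsometryEquiv u (WithLp.toLp 2 (rotateRows u⁻¹ A i)) =
      WithLp.toLp 2 (A i) := unitary_apply_inv_apply u _
  rw [e] at h
  rw [← h]; rfl

/-- A proper subspace lies in the kernel of a nonzero functional `L`, whose law is Gaussian with
variance `‖L‖² ≠ 0` and so has no atom at `0`. -/
lemma pi_gaussianReal_submodule {n : ℕ} (V : Submodule ℝ (Fin n → ℝ)) (hV : V ≠ ⊤) :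
    (Measure.pi fun _ : Fin n => gaussianReal 0 1) (V : Set (Fin n → ℝ)) = 0 := by
  obtain ⟨f, hf, hVf⟩ := V.exists_le_ker_of_lt_top hV.lt_top
  set L : StrongDual ℝ (EuclideanSpace ℝ (Fin n)) :=
    LinearMap.toContinuousLinearMap (f ∘ₗ (WithLp.linearEquiv 2 ℝ (Fin n → ℝ)).toLinearMap)
    with hL
  have hLa (x : Fin n → ℝ) : L (WithLp.toLp 2 x) = f x := rfl
  have hL0 : ‖L‖ ^ 2 ≠ 0 := by
    refine pow_ne_zero 2 (norm_ne_zero_iff.2 fun h => hf ?_)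
    ext x
    simp [← hLa, h]
  have hg := IsGaussian.map_eq_gaussianReal (μ := stdGaussian (EuclideanSpace ℝ (Fin n))) L
  rw [variance_dual_stdGaussian] at hg
  have hna := nullSingletonClass_gaussianReal
    (μ := ∫ x, L x ∂(stdGaussian (EuclideanSpace ℝ (Fin n))))
    (v := (‖L‖ ^ 2).toNNReal) (by
      rw [Ne, Real.toNNReal_eq_zero, not_le]; positivity)
  have h0 : (stdGaussian (EuclideanSpace ℝ (Fin n))).map L {0} = 0 := by
    rw [hg]; exact measure_singleton 0
  rw [Measure.map_apply (by fun_prop) (measurableSet_singleton 0), ← map_pi_eq_stdGaussian,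
    Measure.map_apply (by fun_prop) (L.continuous.measurable (measurableSet_singleton 0))] at h0
  exact measure_mono_null (fun x hx => hVf hx) h0

/-- Independent random vectors whose law gives no mass to proper subspaces are almost surely
linearly independent. -/
lemma ae_linearIndependent_pi {F : Type*} [NormedAddCommGroup F] [NormedSpace ℝ F]
    [FiniteDimensional ℝ F] [MeasurableSpace F] [BorelSpace F] (ν : Measure F)
    [IsProbabilityMeasure ν] (hν : ∀ V : Submodule ℝ F, V ≠ ⊤ → ν V = 0) (m : ℕ)
    (hm : m ≤ Module.finrank ℝ F) :
    ∀ᵐ v ∂(Measure.pi fun _ : Fin m => ν), LinearIndependent ℝ v := by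
  have : ProperSpace F := FiniteDimensional.proper_real F
  induction m with
  | zero => exact .of_forall fun v => linearIndependent_empty_type
  | succ m ih =>
    have hmeas (k : ℕ) : MeasurableSet {v : Fin k → F | LinearIndependent ℝ v} :=
      isOpen_setOfPred_linearIndependent.measurableSet
    have hmp := (measurePreserving_piFinSuccAbove (fun _ : Fin (m + 1) => ν) 0).symm
    rw [← hmp.map_eq, ae_map_iff hmp.measurable.aemeasurable (hmeas _)]
    -- For fixed independent `v`, the new vector almost surely avoids their span, which is proper by
    -- dimension. It is the second factor here so that it is integrated first; a swap restores the
    -- order.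
    have key : ∀ᵐ p ∂((Measure.pi fun _ : Fin m => ν).prod ν),
        LinearIndependent ℝ (Fin.cons p.2 p.1 : Fin (m + 1) → F) := by
      rw [Measure.ae_prod_iff_ae_ae]
      · filter_upwards [ih (by omega)] with v hv
        have hne : Submodule.span ℝ (Set.range v) ≠ ⊤ := fun h => by
          have h1 := finrank_span_eq_card hv
          rw [h, finrank_top, Fintype.card_fin] at h1
          omega
        refine measure_mono_null (fun x hx => ?_) (hν _ hne)
        by_contra hxV
        exact hx (linearIndependent_finCons.2 ⟨hv, hxV⟩)
      · refine isOpen_setOfPred_linearIndependent.measurableSet.preimage ?_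
        exact Continuous.measurable (by fun_prop)
    have hsw := (Measure.measurePreserving_swap (μ := ν)
      (ν := Measure.pi fun _ : Fin m => ν)).quasiMeasurePreserving.ae key
    filter_upwards [hsw] with p hp
    have e : (MeasurableEquiv.piFinSuccAbove (fun _ : Fin (m + 1) => F) 0).symm p =
        Fin.cons p.1 p.2 := by
      exact Fin.insertNth_zero' p.1 p.2
    rw [e]; exact hp

lemma finrank_nullSpace_le {m n : ℕ} {A : Matrix (Fin m) (Fin n) ℝ}
    (hA : LinearIndependent ℝ A.row) : Module.finrank ℝ (nullSpace A) ≤ n - m := by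
  have h1 := hA.rank_matrix
  rw [A.rank_eq_finrank_range_toLin (PiLp.basisFun 2 ℝ (Fin m)) (PiLp.basisFun 2 ℝ (Fin n)),
    ← Matrix.toLpLin_eq_toLin, Fintype.card_fin] at h1
  have h2 := LinearMap.finrank_range_add_finrank_ker (Matrix.toEuclideanLin A)
  rw [finrank_euclideanSpace_fin] at h2
  have h3 : m + Module.finrank ℝ (nullSpace A) = n := (congrArg (· + _) h1).symm.trans h2
  omega

lemma ae_finrank_nullSpace_gaussianMatrix {m n : ℕ} (hmn : m ≤ n) :
    ∀ᵐ A ∂(gaussianMatrix m n), Module.finrank ℝ (nullSpace A) ≤ n - m :=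
  (ae_linearIndependent_pi (Measure.pi fun _ : Fin n => gaussianReal 0 1)
    pi_gaussianReal_submodule m (by simpa using hmn)).mono fun _ hA => finrank_nullSpace_le hA

end Gaussian

/-! ### Probability bounds for both models and the choice of constants. -/

section Main

/-- A random rotation-invariant subspace of proportional codimension is unlikely to contain a
vector whose `ℓ₁` norm is small compared with its Euclidean norm. -/
lemma measure_hasSmallVector_l1Seminorm_le {n : ℕ} [NeZero n] {X : Type*} [TopologicalSpace X]
    [SecondCountableTopology X] [MeasurableSpace X] [BorelSpace X] (μ : Measure X)
    [IsProbabilityMeasure μ] (W : X → Submodule ℝ (EuclideanSpace ℝ (Fin n)))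
    (hW : IsClosed {q : X × EuclideanSpace ℝ (Fin n) | q.2 ∈ W q.1})
    {ε : ℝ} (hε : 0 < ε) (hε2 : ε ≤ 1 / 2) {d : ℕ}
    (hinv : ∀ u : unitary (EuclideanSpace ℝ (Fin n) →L[ℝ] EuclideanSpace ℝ (Fin n)),
      μ {x | HasSmallVector (l1Seminorm n) (ε * √n) ((W x).comap
        (u : EuclideanSpace ℝ (Fin n) →L[ℝ] EuclideanSpace ℝ (Fin n)).toLinearMap)} =
        μ {x | HasSmallVector (l1Seminorm n) (ε * √n) (W x)})
    (hd : ∀ᵐ x ∂μ, Module.finrank ℝ (W x) ≤ d) :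
    μ {x | HasSmallVector (l1Seminorm n) (ε * √n) (W x)} ≤
      ENNReal.ofReal ((2 / ε) ^ d * (Real.exp 1 * (4 * ε)) ^ n) := by
  obtain ⟨H, _, _⟩ := exists_haar_unitary (EuclideanSpace ℝ (Fin n))
  refine measure_hasSmallVector_le H μ _ continuous_l1Seminorm _ W hW hinv ?_
  filter_upwards [hd] with x hx
  refine (haar_hasSmallVector_le H _ continuous_l1Seminorm l1Seminorm_le_sqrt_mul_norm
    (Real.sqrt_nonneg _) hε hε2
    (fun y hy => haar_l1Seminorm_le H (r := 4 * ε) (by positivity) hy) (W x)).trans ?_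
  rw [← ENNReal.ofReal_mul (by positivity)]
  refine ENNReal.ofReal_le_ofReal (mul_le_mul_of_nonneg_right ?_ (by positivity))
  exact pow_le_pow_right₀ (by rw [le_div_iff₀ hε]; linarith) hx

instance secondCountableTopology_grassmann {n d : ℕ} :
    SecondCountableTopology (Grassmann n d) := by
  have : ProperSpace (EuclideanSpace ℝ (Fin n) →L[ℝ] EuclideanSpace ℝ (Fin n)) :=
    FiniteDimensional.proper_real _
  exact Topology.IsInducing.secondCountableTopology (f := Grassmann.proj) ⟨rfl⟩

lemma isClosed_mem_grassmann {n d : ℕ} :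
    IsClosed {q : Grassmann n d × EuclideanSpace ℝ (Fin n) | q.2 ∈ q.1.1} := by
  have hc : Continuous (Grassmann.proj (n := n) (d := d)) := continuous_induced_dom
  have : {q : Grassmann n d × EuclideanSpace ℝ (Fin n) | q.2 ∈ q.1.1} =
      {q | q.1.proj q.2 = q.2} := by
    ext q
    exact Submodule.starProjection_eq_self_iff.symm
  rw [this]
  exact isClosed_eq ((hc.comp continuous_fst).clm_apply continuous_snd) continuous_snd

lemma measure_grassmann_hasSmallVector_le {n d : ℕ} [NeZero n] {μ : Measure (Grassmann n d)}
    (hμ : Grassmann.IsUniform μ) {ε : ℝ} (hε : 0 < ε) (hε2 : ε ≤ 1 / 2) :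
    μ {V | HasSmallVector (l1Seminorm n) (ε * √n) V.1} ≤
      ENNReal.ofReal ((2 / ε) ^ d * (Real.exp 1 * (4 * ε)) ^ n) := by
  have := hμ.1
  refine measure_hasSmallVector_l1Seminorm_le μ (fun V => V.1) isClosed_mem_grassmann hε hε2
    (fun u => ?_) (.of_forall fun V => V.2.le)
  set Θ := Unitary.linearIsometryEquiv u⁻¹
  -- The pushforward along a map that is not a.e. measurable is zero by definition, so invariance
  -- itself yields a.e. measurability of `rotate Θ`.
  have hne : NeZero (μ.map (Grassmann.rotate Θ)) := by
    rw [hμ.2]; exact ⟨IsProbabilityMeasure.ne_zero μ⟩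
  have hmeas : MeasurableSet {V : Grassmann n d |
      HasSmallVector (l1Seminorm n) (ε * √n) V.1} :=
    (isClosed_hasSmallVector _ continuous_l1Seminorm _ _ isClosed_mem_grassmann).measurableSet
  have h := Measure.map_apply_of_aemeasurable (aemeasurable_of_map_neZero hne) hmeas
  rw [hμ.2 Θ] at h
  rw [h]
  congr 1
  ext V
  have e : (Grassmann.rotate Θ V).1 = V.1.comap
      (u : EuclideanSpace ℝ (Fin n) →L[ℝ] EuclideanSpace ℝ (Fin n)).toLinearMap := by
    ext w
    constructor
    · rintro ⟨v, hv, rfl⟩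
      have : (u : EuclideanSpace ℝ (Fin n) →L[ℝ] EuclideanSpace ℝ (Fin n)) (Θ v) = v :=
        unitary_apply_inv_apply u v
      change (u : EuclideanSpace ℝ (Fin n) →L[ℝ] EuclideanSpace ℝ (Fin n)) (Θ v) ∈ V.1
      rwa [this]
    · intro hw
      exact ⟨_, hw, unitary_inv_apply_apply u w⟩
  change _ ↔ HasSmallVector _ _ (Grassmann.rotate Θ V).1
  rw [e]
  rfl

lemma gaussianMatrix_hasSmallVector_le {m n : ℕ} [NeZero n] (hmn : m ≤ n) {ε : ℝ}
    (hε : 0 < ε) (hε2 : ε ≤ 1 / 2) :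
    gaussianMatrix m n {A | HasSmallVector (l1Seminorm n) (ε * √n) (nullSpace A)} ≤
      ENNReal.ofReal ((2 / ε) ^ (n - m) * (Real.exp 1 * (4 * ε)) ^ n) := by
  refine measure_hasSmallVector_l1Seminorm_le _ nullSpace isClosed_mem_nullSpace hε hε2
    (fun u => ?_) (ae_finrank_nullSpace_gaussianMatrix hmn)
  have hmeas : MeasurableSet {A : Matrix (Fin m) (Fin n) ℝ |
      HasSmallVector (l1Seminorm n) (ε * √n) (nullSpace A)} :=
    (isClosed_hasSmallVector _ continuous_l1Seminorm _ _ isClosed_mem_nullSpace).measurableSet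
  rw [← (measurePreserving_rotateRows u⁻¹).measure_preimage hmeas.nullMeasurableSet]
  simp only [Set.preimage_ofPred_eq, nullSpace_rotateRows]

lemma HasUniformNullSpace.hasSmallVector_le {m n : ℕ} [NeZero n]
    {μ : Measure (Matrix (Fin m) (Fin n) ℝ)} (hμ : HasUniformNullSpace μ) {ε : ℝ}
    (hε : 0 < ε) (hε2 : ε ≤ 1 / 2) :
    μ {A | HasSmallVector (l1Seminorm n) (ε * √n) (nullSpace A)} ≤
      ENNReal.ofReal ((2 / ε) ^ (n - m) * (Real.exp 1 * (4 * ε)) ^ n) := by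
  obtain ⟨V, hV, hVA, hu⟩ := hμ
  refine le_trans ?_ ((Measure.le_map_apply hV _).trans
    (measure_grassmann_hasSmallVector_le hu hε hε2))
  refine measure_mono_ae ?_
  filter_upwards [hVA] with A hA h
  change HasSmallVector _ _ (V A).1
  rwa [hA]

/-- Since `m ≥ δn`, this `ε` gives `ε^m ≤ e^{-5n}`, which beats `(8e)^n ≤ e^{4n}`. The summand `δ`
in `5 + δ` keeps the exponent at most `-1`, hence `ε ≤ 1/2`, however large `δ` is. -/
lemma two_div_pow_mul_pow_le {δ ε : ℝ} (hδ : 0 < δ) (hε : ε = Real.exp (-((5 + δ) / δ)))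
    {m n : ℕ} (hmn : m ≤ n) (hm : δ * n ≤ m) :
    (2 / ε) ^ (n - m) * (Real.exp 1 * (4 * ε)) ^ n ≤ Real.exp (-(1 * n)) := by
  have hε0 : 0 < ε := hε ▸ Real.exp_pos _
  have h8 : 8 * Real.exp 1 ≤ Real.exp 4 := by
    have h2 : 2 ≤ Real.exp 1 := by linarith [Real.add_one_le_exp (1 : ℝ)]
    have : Real.exp 4 = Real.exp 1 ^ 3 * Real.exp 1 := by
      rw [← pow_succ, ← Real.exp_nat_mul]; norm_num
    rw [this]
    have := pow_le_pow_left₀ zero_le_two h2 3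
    exact mul_le_mul_of_nonneg_right (by linarith) (Real.exp_pos 1).le
  have hm5 : 5 * (n : ℝ) ≤ m * ((5 + δ) / δ) := by
    rw [mul_div_assoc', le_div_iff₀ hδ]
    have : (0 : ℝ) ≤ m := by positivity
    nlinarith
  calc (2 / ε) ^ (n - m) * (Real.exp 1 * (4 * ε)) ^ n
      = 2 ^ (n - m) * (4 * Real.exp 1) ^ n * ε ^ m := by
        obtain ⟨k, rfl⟩ := Nat.exists_eq_add_of_le hmn
        rw [Nat.add_sub_cancel_left, div_pow,
          show Real.exp 1 * (4 * ε) = 4 * Real.exp 1 * ε by ring,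
          mul_pow _ ε, pow_add ε]
        field_simp
    _ ≤ 2 ^ n * (4 * Real.exp 1) ^ n * ε ^ m := by
        gcongr
        · norm_num
        · exact Nat.sub_le _ _
    _ = (8 * Real.exp 1) ^ n * ε ^ m := by rw [← mul_pow]; ring
    _ ≤ Real.exp 4 ^ n * ε ^ m := by gcongr
    _ = Real.exp (n * 4 + m * -((5 + δ) / δ)) := by
        rw [hε, Real.exp_add, Real.exp_nat_mul, Real.exp_nat_mul]
    _ ≤ Real.exp (-(1 * n)) := Real.exp_le_exp.2 (by linarith)

theorem theorem1 (C δ : ℝ) (hC : 1 < C) (hδ : 0 < δ) :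
    ∃ ζ : ℝ, 0 < ζ ∧ ∃ c : ℝ, 0 < c ∧
      ∀ m : ℕ → ℕ, (∀ n, m n ≤ n) →
        Tendsto (fun n : ℕ => (m n : ℝ) / (n : ℝ)) atTop (𝓝 δ) →
        ∀ᶠ n : ℕ in atTop,
          ∀ μ : Measure (Matrix (Fin (m n)) (Fin n) ℝ),
            (HasUniformNullSpace μ ∨ μ = gaussianMatrix (m n) n) →
            μ {A | ¬ (NullSpaceBalanced A C (ζ * n) ∧ L1Robust A C (ζ * n))} ≤
              ENNReal.ofReal (Real.exp (-(c * n))) := by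
  -- The limit only ensures `m n ≥ (δ/2) n` eventually, so `δ/2` plays the role of `δ`.
  set ε := Real.exp (-((5 + δ / 2) / (δ / 2))) with hε
  have hε0 : 0 < ε := Real.exp_pos _
  have hε2 : ε ≤ 1 / 2 := by
    have h1 : (1 : ℝ) ≤ (5 + δ / 2) / (δ / 2) := by rw [le_div_iff₀ (by positivity)]; linarith
    have h2 := Real.add_one_le_exp ((5 + δ / 2) / (δ / 2))
    rw [hε, Real.exp_neg, one_div]
    exact inv_anti₀ two_pos (by linarith)
  -- This `ζ` solves `(1 + C) √(ζ n) = ε √n`.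
  refine ⟨(ε / (1 + C)) ^ 2, by positivity, 1, one_pos, fun m hmn hlim => ?_⟩
  filter_upwards [hlim.eventually (lt_mem_nhds (half_lt_self hδ)), eventually_gt_atTop 0]
    with n hn hn0 μ hμ
  have : NeZero n := ⟨hn0.ne'⟩
  have hm : δ / 2 * n ≤ m n := (le_div_iff₀ (by exact_mod_cast hn0)).1 hn.le
  refine le_trans (measure_mono (t := {A | HasSmallVector (l1Seminorm n) (ε * √n)
    (nullSpace A)}) fun A hA => ?_) ((?_ : _ ≤ _).trans (ENNReal.ofReal_le_ofReal
      (two_div_pow_mul_pow_le (half_pos hδ) hε (hmn n) hm)))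
  · refine hasSmallVector_nullSpace (C := C) (k := (ε / (1 + C)) ^ 2 * n) (by linarith) ?_
      fun h => hA ⟨h, h.l1Robust hC⟩
    rw [Real.sqrt_mul (by positivity), Real.sqrt_sq (by positivity), ← mul_assoc,
      mul_div_cancel₀ _ (by positivity)]
  · rcases hμ with hμ | rfl
    · exact hμ.hasSmallVector_le hε0 hε2
    · exact gaussianMatrix_hasSmallVector_le (hmn n) hε0 hε2

end Main
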